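/- Let $p\ge 3$ be a prime, let $d\neq 0$ be a rational number whose numerator (in lowest terms) is not divisible by $p$, and let $x\in\mathbb Z_p$ be a $p$-adic integer. Let $\langle x\rangle_p\in\{0,1,\dots,p-1\}$ be the least nonnegative residue of $x$ modulo $p$ and put $m:=(x-\langle x\rangle_p)/p\in\mathbb Z_p$. Write $\binom{y}{k}=y(y-1)\cdots(y-k+1)/k!$ for the generalized binomial coefficient, $H_n^{(2)}=\sum_{k=1}^n 1/k^2$, $q_p(2)=(2^{p-1}-1)/p$, and $$S:=\sum_{k=0}^{\frac{p-1}{2}}\left(x^2+x-(1+4d)k^2-(1-2d)k\right)\frac{d^{-k}\binom{x}{k}\binom{x+k}{k}}{\binom{2k}{k}} .$$ Here $A\equiv B\pmod{p^n}$ means $A-B\in p^n\mathbb Z_p$. Then the following hold. (1) If $p>3$ and $\langle x\rangle_p<(p-1)/2$, then $$S\equiv \frac{(-1)^{\langle x\rangle_p}\,m\left(-\frac1d\right)^{(p-1)/2}}{2\binom{p-1}{\langle x\rangle_p+(p-1)/2}}\left(p+2\langle x\rangle_p\,p+(1+2m)p^2+(1+2\langle x\rangle_p)\,m\,p^3\left(H^{(2)}_{\langle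 x\rangle_p}-4H^{(2)}_{2\langle x\rangle_p}\right)\right)\pmod{p^4}.$$ (2) If $p>3$ and $\langle x\rangle_p=(p-1)/2$, then $$S\equiv \frac{m(1+m)p^2}{4^{p-1}d^{\frac{p-1}{2}}}\left(1+2p\,q_p(2)+p^2q_p(2)^2\right)\pmod{p^5}.$$ (3) If $\langle x\rangle_p>(p-1)/2$, then $$S\equiv \frac{(1+m)p}{d^{\frac{p-1}{2}}}\binom{\langle x\rangle_p+\frac{p+1}{2}}{p+1}\pmod{p^2}.$$ -/

import Mathlib

/-- The generalized harmonic number `H_n^{(r)} = ∑_{k=1}^n 1 / k^r`. -/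
def genHarmonic (r n : ℕ) : ℚ :=
  ∑ k ∈ Finset.Icc 1 n, 1 / (k : ℚ) ^ r

/-- The Fermat quotient `q_p(a) = (a^{p-1} - 1) / p`. -/
def fermatQuotient (p : ℕ) (a : ℤ) : ℚ :=
  ((a : ℚ) ^ (p - 1) - 1) / (p : ℚ)

/-- `a ≡ b (mod p^n)` for `a, b ∈ ℚ_p`: the difference `a - b` lies in `p^n ℤ_p`. -/
def PadicCongr (p : ℕ) [Fact p.Prime] (n : ℕ) (a b : ℚ_[p]) : Prop :=
  ∃ z : ℤ_[p], a - b = (p : ℚ_[p]) ^ n * (z : ℚ_[p])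

/-- The least nonnegative residue of the `p`-adic integer `x` modulo `p`. -/
noncomputable def leastResidue (p : ℕ) [Fact p.Prime] (x : ℤ_[p]) : ℕ :=
  (PadicInt.toZMod x).val

/-- The sum over `0 ≤ k ≤ (p-1)/2` of
`(x² + x - (1+4d) k² - (1-2d) k) · d^{-k} · C(x,k) · C(x+k,k) / C(2k,k)`,
where `C(y,k) = y (y-1) ⋯ (y-k+1) / k!` is the generalized binomial coefficient,
a `p`-adic integer for `y ∈ ℤ_p`. -/
noncomputable def halfSum (p : ℕ) [Fact p.Prime] (d : ℚ) (x : ℤ_[p]) : ℚ_[p] :=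
  ∑ k ∈ Finset.range ((p - 1) / 2 + 1),
    ((x : ℚ_[p]) ^ 2 + (x : ℚ_[p]) - (1 + 4 * (d : ℚ_[p])) * (k : ℚ_[p]) ^ 2
        - (1 - 2 * (d : ℚ_[p])) * (k : ℚ_[p]))
      * (((d : ℚ_[p]) ^ k)⁻¹ * ((Ring.choose x k : ℤ_[p]) : ℚ_[p])
          * ((Ring.choose (x + (k : ℤ_[p])) k : ℤ_[p]) : ℚ_[p])
          / ((Nat.choose (2 * k) k : ℕ) : ℚ_[p]))

/-!
Since `C(x,k) C(x+k,k) / C(2k,k) = C(x+k,2k)`, the sum telescopes: with `n = (p-1)/2` it equals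
`d^{-n} p (p+1) C(x+n+1, p+1)`. Write `x = a + pM`. If `a > n`, one factor `p` is visible and Lucas'
theorem gives the rest. If `a ≤ n`, put `b = n - a` and `N = 2a + b`; then `p (p+1) C(x+n+1, p+1)`
is `pM (pM+N+1) C(pM-1, b) C(pM+N, N)` divided by the unit `C(p-1, N)`. Moving one factor at a time
from `C(pM+N, N)` to `C(pM-1, b)` shows that `(-1)^b C(pM-1, b) C(pM+N, N)` is congruent to
`C(pM+p-1, p-1) (1 + p² M H_b^{(2)})` modulo `p³`. The same congruence at `N = 0` yields
Wolstenholme's `C(pM+p-1, p-1) ≡ 1` modulo `p³`, and `H_b^{(2)} ≡ H_a^{(2)} - 4 H_{2a}^{(2)}`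
modulo `p`. Lucas and Wolstenholme pass from natural numbers `M` to `ℤ_p` by density.
-/

open Finset

section BinomialRing

variable {R : Type*} [CommRing R] [BinomialRing R]

theorem succ_mul_ringChoose_succ (r : R) (k : ℕ) :
    ((k : R) + 1) * Ring.choose r (k + 1) = (r - k) * Ring.choose r k := by
  have h := Ring.choose_smul_choose r k.le_succ
  simp only [Nat.succ_eq_add_one, Nat.choose_succ_self_right, nsmul_eq_mul,
    Nat.add_sub_cancel_left, Ring.choose_one_right, Nat.cast_add, Nat.cast_one] at h
  rw [h, mul_comm]

theorem succ_mul_ringChoose_succ_eq_mul_sub_one (r : R) (k : ℕ) :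
    ((k : R) + 1) * Ring.choose r (k + 1) = r * Ring.choose (r - 1) k := by
  have h := Ring.choose_smul_choose r (Nat.succ_le_succ k.zero_le)
  simpa only [Nat.succ_eq_add_one, zero_add, Nat.choose_one_right, nsmul_eq_mul, Nat.cast_add,
    Nat.cast_one, Ring.choose_one_right, Nat.add_sub_cancel] using h

theorem succ_mul_ringChoose_add_one_succ (r : R) (k : ℕ) :
    ((k : R) + 1) * Ring.choose (r + 1) (k + 1) = (r + 1) * Ring.choose r k := by
  rw [succ_mul_ringChoose_succ_eq_mul_sub_one, add_sub_cancel_right]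

theorem mul_ringChoose_two_mul_add_two (x : R) (n : ℕ) :
    (2 * n + 1) * (2 * n + 2) * Ring.choose (x + n + 1) (2 * n + 2)
      = (x - n) * (x + n + 1) * Ring.choose (x + n) (2 * n) := by
  have hlower := succ_mul_ringChoose_succ (x + n) (2 * n)
  have hupper := succ_mul_ringChoose_add_one_succ (x + n) (2 * n + 1)
  push_cast at hlower hupper
  linear_combination (2 * (n : R) + 1) * hupper + (x + n + 1) * hlower

theorem sum_mul_pow_mul_ringChoose {d e : R} (hde : d * e = 1) (x : R) (n : ℕ) :
    ∑ k ∈ range (n + 1), (x ^ 2 + x - (1 + 4 * d) * k ^ 2 - (1 - 2 * d) * k)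
        * (e ^ k * Ring.choose (x + k) (2 * k))
      = e ^ n * ((2 * n + 1) * (2 * n + 2) * Ring.choose (x + n + 1) (2 * n + 2)) := by
  induction n with
  | zero =>
    rw [mul_ringChoose_two_mul_add_two]
    simp
    ring
  | succ n ih =>
    rw [sum_range_succ, ih, mul_ringChoose_two_mul_add_two x (n + 1)]
    push_cast
    rw [← add_assoc x, mul_add_one 2 n]
    linear_combination (-(2 * (n : R) + 1) * (2 * n + 2) * e ^ n
      * Ring.choose (x + n + 1) (2 * n + 2)) * hde

theorem choose_mul_ringChoose_add (t : R) {N b q : ℕ} (h : N + b + 1 = q) :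
    ((q - 1).choose N : R) * (q * (q + 1) * Ring.choose (t + N + 1) (q + 1))
      = t * (t + N + 1) * (Ring.choose (t - 1) b * Ring.choose (t + N) N) := by
  subst h
  have htop := succ_mul_ringChoose_add_one_succ (t + N) (N + b + 1)
  have hsplit := Ring.choose_smul_choose (t + N) (Nat.le_add_right N (b + 1))
  have hnat := congrArg (Nat.cast (R := R)) (Nat.choose_mul_succ_eq (N + b) N)
  have hlow := succ_mul_ringChoose_succ_eq_mul_sub_one t b
  rw [nsmul_eq_mul, add_sub_cancel_right, Nat.add_sub_cancel_left, ← add_assoc] at hsplit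
  rw [show N + b + 1 - N = b + 1 by omega] at hnat
  rw [Nat.add_sub_cancel]
  push_cast at htop hnat ⊢
  linear_combination ((N + b).choose N * (N + b + 1) : R) * htop
    + (t + N + 1) * Ring.choose (t + N) (N + b + 1) * hnat
    + (t + N + 1) * (b + 1) * hsplit + (t + N + 1) * Ring.choose (t + N) N * hlow

theorem succ_mul_mul_ringChoose_mul_ringChoose (t : R) (b N : ℕ) :
    (b + 1) * (t + N + 1) * (Ring.choose (t - 1) (b + 1) * Ring.choose (t + N) N)
      = (t - (b + 1)) * (N + 1) *
        (Ring.choose (t - 1) b * Ring.choose (t + (N + 1 : ℕ)) (N + 1)) := by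
  have hb := succ_mul_ringChoose_succ (t - 1) b
  have hN := succ_mul_ringChoose_add_one_succ (t + N) N
  push_cast
  rw [← add_assoc]
  linear_combination (t + N + 1) * Ring.choose (t + N) N * hb
    - (t - (b + 1)) * Ring.choose (t - 1) b * hN

end BinomialRing

section Harmonic

/-- The harmonic number `H_n^{(2)} = ∑_{i=1}^n 1 / i²` in an arbitrary ring, so that the same
expression can be read in `ℚ_[p]`, in `ℤ_[p]` and modulo `p`. Terms with `i` not invertible in `R`
count as `0`. -/
noncomputable def harmonicSq (R : Type*) [Ring R] (n : ℕ) : R :=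
  ∑ i ∈ Icc 1 n, Ring.inverse (i : R) ^ 2

theorem harmonicSq_zero (R : Type*) [Ring R] : harmonicSq R 0 = 0 := by
  simp [harmonicSq]

theorem harmonicSq_succ (R : Type*) [Ring R] (n : ℕ) :
    harmonicSq R (n + 1) = harmonicSq R n + Ring.inverse ((n + 1 : ℕ) : R) ^ 2 :=
  sum_Icc_succ_top n.succ_pos _

theorem map_harmonicSq {R S : Type*} [Ring R] [Ring S] (f : R →+* S) {n : ℕ}
    (hn : ∀ i ∈ Icc 1 n, IsUnit (i : R)) : f (harmonicSq R n) = harmonicSq S n := by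
  rw [harmonicSq, harmonicSq, map_sum]
  refine sum_congr rfl fun i hi => ?_
  obtain ⟨u, hu⟩ := hn i hi
  have hfu : (i : S) = Units.map (f : R →* S) u := by simp [hu]
  rw [map_pow, hfu, ← hu, Ring.inverse_unit, Ring.inverse_unit, ← map_inv]
  rfl

theorem genHarmonic_two_cast (K : Type*) [Field K] [CharZero K] (n : ℕ) :
    (genHarmonic 2 n : K) = harmonicSq K n := by
  simp [genHarmonic, harmonicSq]

variable {K : Type*} [Field K] {p : ℕ} [CharP K p]

theorem harmonicSq_add_harmonicSq {N b : ℕ} (h : N + b + 1 = p) :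
    harmonicSq K N + harmonicSq K b = harmonicSq K (N + b) := by
  induction b generalizing N with
  | zero => rw [harmonicSq_zero, add_zero, add_zero]
  | succ b ih =>
    have hrefl : ((N + 1 : ℕ) : K) = -((b + 1 : ℕ) : K) := by
      rw [eq_neg_iff_add_eq_zero, ← Nat.cast_add, ← CharP.cast_eq_zero K p]
      congr 1; omega
    have hstep := ih (N := N + 1) (by omega)
    rw [harmonicSq_succ, hrefl, Ring.inverse_eq_inv', inv_neg, neg_sq] at hstep
    rw [harmonicSq_succ, Ring.inverse_eq_inv', ← add_assoc N b 1, add_right_comm N b 1, ← hstep]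
    ring

theorem harmonicSq_add_four_mul {a b : ℕ} (h : p = 2 * (a + b) + 1) :
    harmonicSq K b + 4 * harmonicSq K (2 * a) = harmonicSq K (a + b) + harmonicSq K a := by
  induction a generalizing b with
  | zero => simp [harmonicSq_zero]
  | succ a ih =>
    have h_two : (2 : K) ≠ 0 := Ring.two_ne_zero (by rw [ringChar.eq K p]; omega)
    have hodd : ((2 * a + 1 : ℕ) : K) = -(2 * ((b + 1 : ℕ) : K)) := by
      rw [eq_neg_iff_add_eq_zero, ← CharP.cast_eq_zero K p, h]
      push_cast; ring
    have heven : ((2 * a + 1 + 1 : ℕ) : K) = 2 * ((a + 1 : ℕ) : K) := by push_cast; ring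
    have hstep := ih (b := b + 1) (by omega)
    rw [mul_add_one, harmonicSq_succ, harmonicSq_succ, harmonicSq_succ, hodd, heven,
      show a + 1 + b = a + (b + 1) by ring]
    rw [harmonicSq_succ] at hstep
    simp only [Ring.inverse_eq_inv', inv_neg, mul_inv] at hstep ⊢
    have h_half : (2 : K) * 2⁻¹ = 1 := mul_inv_cancel₀ h_two
    linear_combination hstep + (2 * 2⁻¹ + 1)
      * (((b + 1 : ℕ) : K)⁻¹ ^ 2 + ((a + 1 : ℕ) : K)⁻¹ ^ 2) * h_half

theorem harmonicSq_half_eq_zero {n : ℕ} (h : p = 2 * n + 1) (hp : 3 < p) :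
    harmonicSq K n = 0 := by
  have hdouble := harmonicSq_add_harmonicSq (K := K) (N := n) (b := n) (by omega)
  have hfour := harmonicSq_add_four_mul (K := K) (a := n) (b := 0) (by omega)
  rw [harmonicSq_zero, add_zero, two_mul n, ← hdouble] at hfour
  have hsix : ((6 : ℕ) : K) * harmonicSq K n = 0 := by push_cast; linear_combination hfour
  refine (mul_eq_zero.1 hsix).resolve_left fun h6 => ?_
  have hdvd : p ∣ 6 := (CharP.cast_eq_zero_iff K p 6).1 h6
  have hle : p ≤ 6 := Nat.le_of_dvd (by norm_num) hdvd
  interval_cases p <;> omega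

theorem harmonicSq_eq_sub_four_mul {a b : ℕ} (h : p = 2 * (a + b) + 1) (hp : 3 < p) :
    harmonicSq K b = harmonicSq K a - 4 * harmonicSq K (2 * a) := by
  have hfour := harmonicSq_add_four_mul (K := K) h
  rw [harmonicSq_half_eq_zero h hp] at hfour
  linear_combination hfour

end Harmonic

section PadicInt

variable {p : ℕ} [Fact p.Prime]

theorem natCast_dvd_iff_toZMod_eq_zero {z : ℤ_[p]} : (p : ℤ_[p]) ∣ z ↔ PadicInt.toZMod z = 0 := by
  rw [← RingHom.mem_ker, PadicInt.ker_toZMod, PadicInt.maximalIdeal_eq_span_p,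
    Ideal.mem_span_singleton]

theorem isUnit_natCast_mul_add {c : ℕ} (hc₀ : c ≠ 0) (hc : c < p) (M : ℤ_[p]) :
    IsUnit ((p : ℤ_[p]) * M + c) := by
  by_contra h
  rw [PadicInt.not_isUnit_iff, PadicInt.norm_lt_one_iff_dvd, natCast_dvd_iff_toZMod_eq_zero] at h
  simp only [map_add, map_mul, map_natCast, CharP.cast_eq_zero, zero_mul, zero_add,
    ZMod.natCast_eq_zero_iff] at h
  exact Nat.not_dvd_of_pos_of_lt (Nat.pos_of_ne_zero hc₀) hc h

theorem isUnit_natCast_of_lt {c : ℕ} (hc₀ : c ≠ 0) (hc : c < p) : IsUnit (c : ℤ_[p]) := by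
  simpa using isUnit_natCast_mul_add hc₀ hc (0 : ℤ_[p])

theorem pow_dvd_of_forall_natCast {f : ℤ_[p] → ℤ_[p]} (hf : Continuous f) {k : ℕ}
    (h : ∀ n : ℕ, (p : ℤ_[p]) ^ k ∣ f n) (x : ℤ_[p]) : (p : ℤ_[p]) ^ k ∣ f x := by
  have hball (z : ℤ_[p]) : (p : ℤ_[p]) ^ k ∣ z ↔ ‖z‖ ≤ (p : ℝ) ^ (-k : ℤ) := by
    rw [PadicInt.norm_le_pow_iff_mem_span_pow, Ideal.mem_span_singleton]
  simp only [hball] at h ⊢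
  exact PadicInt.denseRange_natCast.induction_on x (isClosed_le hf.norm continuous_const) h

theorem natCast_dvd_ringChoose_sub {c : ℕ} (hc : c < p) (M : ℤ_[p]) :
    (p : ℤ_[p]) ∣ Ring.choose (p * M + c) p - M := by
  have hp : 0 < p := Nat.pos_of_neZero p
  have hcont : Continuous fun M : ℤ_[p] => Ring.choose (p * M + c) p - M :=
    ((PadicInt.continuous_choose p).comp (by fun_prop)).sub continuous_id
  have h := pow_dvd_of_forall_natCast (k := 1) hcont (fun M => ?_) M
  · simpa only [pow_one] using h
  have hlucas :=
    Choose.choose_modEq_choose_mod_mul_choose_div_nat (p := p) (n := p * M + c) (k := p)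
  rw [Nat.mod_self, Nat.div_self hp, Nat.mul_add_div hp, Nat.div_eq_of_lt hc, add_zero,
    Nat.choose_zero_right, Nat.choose_one_right, one_mul, ← ZMod.natCast_eq_natCast_iff] at hlucas
  have hcast : (p : ℤ_[p]) * M + c = (p * M + c : ℕ) := by push_cast; rfl
  simp only [hcast, Ring.choose_natCast, pow_one, natCast_dvd_iff_toZMod_eq_zero, map_sub,
    map_natCast, hlucas, sub_self]

theorem pow_three_dvd_ringChoose_mul_ringChoose_sub {N b : ℕ} (h : N + b + 1 = p) (M : ℤ_[p]) :
    (p : ℤ_[p]) ^ 3 ∣ (-1) ^ b * (Ring.choose (p * M - 1) b * Ring.choose (p * M + N) N)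
      - Ring.choose (p * M + (p - 1 : ℕ)) (p - 1)
        * (1 + p ^ 2 * M * harmonicSq ℤ_[p] b) := by
  induction b generalizing N with
  | zero =>
    obtain rfl : N = p - 1 := by omega
    simp [harmonicSq_zero]
  | succ b ih =>
    obtain ⟨c, hc⟩ := ih (N := N + 1) (by omega)
    set F := Ring.choose (p * M + (p - 1 : ℕ)) (p - 1)
    set H := harmonicSq ℤ_[p] b with hH
    -- Passing from `(b, N + 1)` to `(b + 1, N)` multiplies by `1 - p ^ 2 M / (i (pM + p - i))` with
    -- `i = b + 1`, which is `1 + p ^ 2 M / i ^ 2` modulo `p ^ 3`.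
    have hrec := succ_mul_mul_ringChoose_mul_ringChoose (p * M) b N
    have hN : (N : ℤ_[p]) = p - b - 2 := by
      have hcast := congrArg (Nat.cast (R := ℤ_[p])) h
      push_cast at hcast
      linear_combination hcast
    have hi : IsUnit ((b + 1 : ℕ) : ℤ_[p]) := isUnit_natCast_of_lt b.succ_ne_zero (by omega)
    have hj : IsUnit (p * M + (N + 1 : ℕ)) := isUnit_natCast_mul_add N.succ_ne_zero (by omega) M
    have hinv := Ring.mul_inverse_cancel _ hi
    rw [harmonicSq_succ, ← hH, ← ((hi.pow 2).mul hj).dvd_mul_left]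
    set u := Ring.inverse ((b + 1 : ℕ) : ℤ_[p])
    push_cast at hinv hrec hc ⊢
    rw [hN] at hrec hc ⊢
    refine ⟨(b + 1) ^ 2 * (p * M + (p - (b + 1))) * c
      - (b + 1) * M * (p * M * H * F + p ^ 2 * c) - (M + 1) * F * M, ?_⟩
    linear_combination (-1) ^ (b + 1) * ((b : ℤ_[p]) + 1) * hrec
      + ((b : ℤ_[p]) + 1) * (b + 1 - p * M) * (p - (b + 1)) * hc
      - (p * M + (p - (b + 1))) * F * p ^ 2 * M * ((b + 1) * u + 1) * hinv

theorem toZMod_harmonicSq {n : ℕ} (hn : n < p) :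
    PadicInt.toZMod (harmonicSq ℤ_[p] n) = harmonicSq (ZMod p) n := by
  refine map_harmonicSq _ fun i hi => ?_
  rw [mem_Icc] at hi
  exact isUnit_natCast_of_lt (by omega) (by omega)

theorem natCast_dvd_harmonicSq_pred (hp : 3 < p) : (p : ℤ_[p]) ∣ harmonicSq ℤ_[p] (p - 1) := by
  obtain ⟨n, hn⟩ := Nat.Prime.odd_of_ne_two (p := p) Fact.out (by omega)
  have hadd := harmonicSq_add_harmonicSq (K := ZMod p) (N := n) (b := n) (by omega)
  rw [natCast_dvd_iff_toZMod_eq_zero, toZMod_harmonicSq (by omega), show p - 1 = n + n by omega,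
    ← hadd, harmonicSq_half_eq_zero hn hp, add_zero]

theorem natCast_dvd_harmonicSq_sub {a b : ℕ} (h : p = 2 * (a + b) + 1) (hp : 3 < p) :
    (p : ℤ_[p]) ∣ harmonicSq ℤ_[p] b - (harmonicSq ℤ_[p] a - 4 * harmonicSq ℤ_[p] (2 * a)) := by
  rw [natCast_dvd_iff_toZMod_eq_zero, map_sub, map_sub, map_mul, map_ofNat,
    toZMod_harmonicSq (by omega), toZMod_harmonicSq (by omega), toZMod_harmonicSq (by omega),
    harmonicSq_eq_sub_four_mul h hp, sub_self]

theorem pow_three_dvd_ringChoose_sub_one (hp : 3 < p) (M : ℤ_[p]) :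
    (p : ℤ_[p]) ^ 3 ∣ Ring.choose (p * M + (p - 1 : ℕ)) (p - 1) - 1 := by
  refine pow_dvd_of_forall_natCast (f := fun M => Ring.choose (p * M + (p - 1 : ℕ)) (p - 1) - 1)
    (((PadicInt.continuous_choose (p - 1)).comp (by fun_prop)).sub continuous_const)
    (fun k => ?_) M
  induction k with
  | zero => simp [Ring.choose_natCast]
  | succ k ih =>
    have hkey := pow_three_dvd_ringChoose_mul_ringChoose_sub (p := p) (N := 0) (b := p - 1)
      (by omega) (k + 1)
    -- With `N = 0` the product is `C(p(k+1) - 1, p - 1)`, the same coefficient one step earlier.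
    obtain ⟨h, hh⟩ := natCast_dvd_harmonicSq_pred hp
    have heven : Even (p - 1) := Nat.Prime.even_sub_one Fact.out (by omega)
    have hpred : (p : ℤ_[p]) * (k + 1) - 1 = p * k + (p - 1 : ℕ) := by
      rw [Nat.cast_sub (by omega)]; push_cast; ring
    rw [heven.neg_one_pow, one_mul, Ring.choose_zero_right, mul_one, hpred, hh] at hkey
    obtain ⟨c, hc⟩ := hkey
    obtain ⟨c', hc'⟩ := ih
    rw [Nat.cast_succ]
    refine ⟨c' - c - Ring.choose (p * (k + 1) + (p - 1 : ℕ) : ℤ_[p]) (p - 1) * (k + 1) * h, ?_⟩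
    linear_combination hc' - hc

theorem pow_three_dvd_ringChoose_mul_ringChoose_sub_one_add {a b : ℕ} (h : p = 2 * (a + b) + 1)
    (hp : 3 < p) (M : ℤ_[p]) :
    (p : ℤ_[p]) ^ 3 ∣ (-1) ^ b * (Ring.choose (p * M - 1) b *
        Ring.choose (p * M + (2 * a + b : ℕ)) (2 * a + b))
      - (1 + p ^ 2 * M * (harmonicSq ℤ_[p] a - 4 * harmonicSq ℤ_[p] (2 * a))) := by
  obtain ⟨q, hq⟩ := pow_three_dvd_ringChoose_mul_ringChoose_sub (N := 2 * a + b) (b := b)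
    (by omega) M
  obtain ⟨r, hr⟩ := pow_three_dvd_ringChoose_sub_one hp M
  obtain ⟨s, hs⟩ := natCast_dvd_harmonicSq_sub h hp
  refine ⟨q + r * (1 + p ^ 2 * M * harmonicSq ℤ_[p] b) + M * s, ?_⟩
  linear_combination hq + (1 + p ^ 2 * M * harmonicSq ℤ_[p] b) * hr + p ^ 2 * M * hs

theorem pow_four_dvd_mul_ringChoose_sub {a b : ℕ} (h : p = 2 * (a + b) + 1) (hp : 3 < p)
    (M : ℤ_[p]) :
    (p : ℤ_[p]) ^ 4 ∣ 2 * (p - 1).choose (2 * a + b)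
        * (p * (p + 1) * Ring.choose (p * M + (2 * a + b : ℕ) + 1) (p + 1))
      - (-1) ^ b * M * (p + 2 * a * p + (1 + 2 * M) * p ^ 2
        + (1 + 2 * a) * M * p ^ 3 * (harmonicSq ℤ_[p] a - 4 * harmonicSq ℤ_[p] (2 * a))) := by
  obtain ⟨c, hc⟩ := pow_three_dvd_ringChoose_mul_ringChoose_sub_one_add h hp M
  have hprod := choose_mul_ringChoose_add (p * M) (show 2 * a + b + b + 1 = p by omega)
  have hdouble : 2 * (((2 * a + b : ℕ) : ℤ_[p]) + 1) = 1 + 2 * a + p := by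
    have hcast := congrArg (Nat.cast (R := ℤ_[p])) h
    push_cast at hcast ⊢
    linear_combination -hcast
  have hsign : ((-1 : ℤ_[p]) ^ b) ^ 2 = 1 := by rw [pow_right_comm, neg_one_sq, one_pow]
  set W := Ring.choose (p * M - 1) b * Ring.choose (p * M + (2 * a + b : ℕ)) (2 * a + b)
  set Z := harmonicSq ℤ_[p] a - 4 * harmonicSq ℤ_[p] (2 * a)
  set K := 1 + 2 * a + (1 + 2 * M) * p
  refine ⟨(-1) ^ b * (M * K * c + M ^ 2 * (1 + 2 * M) * Z), ?_⟩
  linear_combination 2 * hprod + p * M * W * hdouble + (-1) ^ b * p * M * K * hc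
    - p * M * K * W * hsign

theorem pow_five_dvd_mul_ringChoose_sub (hp : 3 < p) (M : ℤ_[p]) :
    (p : ℤ_[p]) ^ 5 ∣ p * (p + 1) * Ring.choose (p * M + p) (p + 1) - p ^ 2 * M * (1 + M) := by
  obtain ⟨c, hc⟩ := pow_three_dvd_ringChoose_sub_one hp M
  have hprod := choose_mul_ringChoose_add (p * M) (N := p - 1) (b := 0) (q := p) (by omega)
  rw [Nat.choose_self, Nat.cast_one, one_mul, add_assoc (p * M : ℤ_[p]) _ 1,
    Ring.choose_zero_right, one_mul, Nat.cast_pred (by omega), sub_add_cancel] at hprod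
  rw [Nat.cast_pred (by omega)] at hc
  refine ⟨M * (1 + M) * c, ?_⟩
  linear_combination hprod + p ^ 2 * M * (1 + M) * hc

theorem natCast_dvd_mul_ringChoose_add_one_sub {c : ℕ} (hc : c < p) (M : ℤ_[p]) :
    (p : ℤ_[p]) ∣ (p + 1) * Ring.choose (p * M + c) (p + 1) - c * M := by
  obtain ⟨g, hg⟩ := natCast_dvd_ringChoose_sub hc M
  refine ⟨c * g + (M - 1) * Ring.choose (p * M + c) p, ?_⟩
  linear_combination succ_mul_ringChoose_succ (p * M + c) p + (c : ℤ_[p]) * hg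

theorem sq_dvd_mul_ringChoose_sub {c : ℕ} (hc : c < p) (M : ℤ_[p]) :
    (p : ℤ_[p]) ^ 2 ∣ p * (p + 1) * Ring.choose (p * (M + 1) + c) (p + 1)
      - p * (1 + M) * (p + c).choose (p + 1) := by
  obtain ⟨g, hg⟩ := natCast_dvd_mul_ringChoose_add_one_sub hc (M + 1)
  obtain ⟨g', hg'⟩ := natCast_dvd_mul_ringChoose_add_one_sub hc (1 : ℤ_[p])
  rw [mul_one, ← Nat.cast_add, Ring.choose_natCast] at hg'
  refine ⟨g - (1 + M) * (g' - (p + c).choose (p + 1)), ?_⟩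
  linear_combination (p : ℤ_[p]) * hg - p * (1 + M) * hg'

end PadicInt

section HalfSum

variable {p : ℕ} [Fact p.Prime]

theorem coe_ringChoose (x : ℤ_[p]) (k : ℕ) :
    ((Ring.choose x k : ℤ_[p]) : ℚ_[p]) = Ring.choose (x : ℚ_[p]) k :=
  Ring.map_choose PadicInt.Coe.ringHom x k

theorem coe_ofNat (k : ℕ) [k.AtLeastTwo] :
    ((OfNat.ofNat k : ℤ_[p]) : ℚ_[p]) = OfNat.ofNat k :=
  map_ofNat PadicInt.Coe.ringHom k

theorem coe_harmonicSq {n : ℕ} (hn : n < p) :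
    ((harmonicSq ℤ_[p] n : ℤ_[p]) : ℚ_[p]) = genHarmonic 2 n := by
  rw [genHarmonic_two_cast]
  refine map_harmonicSq PadicInt.Coe.ringHom fun i hi => ?_
  rw [mem_Icc] at hi
  exact isUnit_natCast_of_lt (by omega) (by omega)

theorem halfSum_eq {d : ℚ} (hd : d ≠ 0) {n : ℕ} (hn : p = 2 * n + 1) (x : ℤ_[p]) :
    halfSum p d x = ((d : ℚ_[p]) ^ n)⁻¹
      * ((p * (p + 1) * Ring.choose (x + n + 1) (p + 1) : ℤ_[p]) : ℚ_[p]) := by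
  have hd' : (d : ℚ_[p]) ≠ 0 := Rat.cast_ne_zero.2 hd
  have hsum := sum_mul_pow_mul_ringChoose (mul_inv_cancel₀ hd') (x : ℚ_[p]) n
  have hterm (k : ℕ) : ((d : ℚ_[p]) ^ k)⁻¹ * Ring.choose (x : ℚ_[p]) k
        * Ring.choose ((x : ℚ_[p]) + k) k / ((2 * k).choose k : ℕ)
      = (d : ℚ_[p])⁻¹ ^ k * Ring.choose ((x : ℚ_[p]) + k) (2 * k) := by
    have hchoose := Ring.choose_add_smul_choose (x : ℚ_[p]) k k
    have hne : (((2 * k).choose k : ℕ) : ℚ_[p]) ≠ 0 :=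
      Nat.cast_ne_zero.2 (Nat.choose_pos (by omega)).ne'
    rw [nsmul_eq_mul, ← two_mul] at hchoose
    rw [div_eq_iff hne, inv_pow]
    linear_combination -((d : ℚ_[p]) ^ k)⁻¹ * hchoose
  have hcast : (p : ℚ_[p]) = 2 * n + 1 := by simpa using congrArg (Nat.cast (R := ℚ_[p])) hn
  rw [halfSum, show (p - 1) / 2 = n by omega, show p + 1 = 2 * n + 2 by omega]
  push_cast [coe_ringChoose, hterm]
  rw [hsum, inv_pow, hcast, add_assoc (2 * n : ℚ_[p]) 1 1, one_add_one_eq_two]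

theorem ne_zero_of_not_dvd_num {k : ℤ} {d : ℚ} (hd : ¬ k ∣ d.num) : d ≠ 0 := by
  rintro rfl
  exact hd (dvd_zero k)

theorem norm_pow_inv_le_one {d : ℚ} (hd : ¬ (p : ℤ) ∣ d.num) (n : ℕ) :
    ‖((d : ℚ_[p]) ^ n)⁻¹‖ ≤ 1 := by
  rw [← inv_pow, norm_pow, ← Rat.cast_inv]
  refine pow_le_one₀ (norm_nonneg _) (Padic.norm_rat_le_one ?_)
  rwa [Rat.den_inv_of_ne_zero (ne_zero_of_not_dvd_num hd), ← Int.natCast_dvd]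

theorem norm_two_mul_choose {N : ℕ} (hp : p ≠ 2) (hN : N < p) :
    ‖(2 * (p - 1).choose N : ℚ_[p])‖ = 1 := by
  have hprime : p.Prime := Fact.out
  have hcop : p.Coprime (2 * (p - 1).choose N) :=
    ((Nat.coprime_primes hprime Nat.prime_two).2 hp).mul_right
      (hprime.coprime_choose_of_lt (Nat.pred_lt hprime.ne_zero) (by omega))
  exact_mod_cast Padic.norm_natCast_eq_one_iff.2 hcop

theorem PadicCongr.mul_left {k : ℕ} {e : ℚ_[p]} (he : ‖e‖ ≤ 1) {y z : ℤ_[p]}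
    (h : (p : ℤ_[p]) ^ k ∣ y - z) : PadicCongr p k (e * y) (e * z) := by
  obtain ⟨e, rfl⟩ : ∃ e' : ℤ_[p], (e' : ℚ_[p]) = e := ⟨⟨e, he⟩, rfl⟩
  obtain ⟨c, hc⟩ := h
  refine ⟨e * c, ?_⟩
  rw [← mul_sub, ← PadicInt.coe_sub, hc]
  push_cast
  ring

theorem one_add_mul_fermatQuotient (a : ℤ) :
    1 + (p : ℚ_[p]) * (fermatQuotient p a : ℚ_[p]) = (a : ℚ_[p]) ^ (p - 1) := by
  have hp : (p : ℚ_[p]) ≠ 0 := Nat.cast_ne_zero.2 (NeZero.ne p)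
  rw [fermatQuotient]
  push_cast
  rw [mul_div_cancel₀ _ hp, add_sub_cancel]

theorem exists_eq_leastResidue_add_mul (x : ℤ_[p]) : ∃ M : ℤ_[p], x = leastResidue p x + p * M := by
  have h : (p : ℤ_[p]) ∣ x - leastResidue p x := by
    rw [natCast_dvd_iff_toZMod_eq_zero, map_sub, map_natCast, leastResidue, ZMod.natCast_zmod_val,
      sub_self]
  obtain ⟨M, hM⟩ := h
  exact ⟨M, eq_add_of_sub_eq' hM⟩

theorem halfSum_congr_of_lt {d : ℚ} (hd : ¬ (p : ℤ) ∣ d.num) {a b : ℕ}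
    (h : p = 2 * (a + b) + 1) (hp : 3 < p) (M : ℤ_[p]) :
    PadicCongr p 4 (halfSum p d (a + p * M))
      ((-1) ^ a * M * (-1 / d) ^ (a + b) / (2 * (p - 1).choose (a + (a + b)))
        * (p + 2 * a * p + (1 + 2 * M) * p ^ 2
          + (1 + 2 * a) * M * p ^ 3 * (genHarmonic 2 a - 4 * genHarmonic 2 (2 * a)))) := by
  have hunit := norm_two_mul_choose (p := p) (N := 2 * a + b) (by omega) (by omega)
  have hne : (2 * (p - 1).choose (2 * a + b) : ℚ_[p]) ≠ 0 := norm_ne_zero_iff.1 (by simp [hunit])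
  have hnorm : ‖((d : ℚ_[p]) ^ (a + b))⁻¹ / (2 * (p - 1).choose (2 * a + b))‖ ≤ 1 := by
    rw [norm_div, hunit, div_one]
    exact norm_pow_inv_le_one hd _
  have hsign : (-1 : ℚ_[p]) ^ a * (-1) ^ (a + b) = (-1) ^ b := by
    rw [pow_add, ← mul_assoc, ← mul_pow, neg_one_mul, neg_neg, one_pow, one_mul]
  have harg : (a + p * M + (a + b : ℕ) + 1 : ℤ_[p]) = p * M + (2 * a + b : ℕ) + 1 := by
    push_cast; ring
  rw [halfSum_eq (ne_zero_of_not_dvd_num hd) h, harg, show a + (a + b) = 2 * a + b by ring]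
  convert PadicCongr.mul_left hnorm (pow_four_dvd_mul_ringChoose_sub h hp M) using 1
  · rw [PadicInt.coe_mul (2 * _), PadicInt.coe_mul 2, PadicInt.coe_natCast, coe_ofNat,
      ← mul_assoc, div_mul_cancel₀ _ hne]
  · push_cast
    rw [coe_ofNat, coe_ofNat, coe_harmonicSq (by omega), coe_harmonicSq (by omega), div_pow,
      ← hsign]
    ring

theorem halfSum_congr_of_eq {d : ℚ} (hd : ¬ (p : ℤ) ∣ d.num) {n : ℕ}
    (h : p = 2 * n + 1) (hp : 3 < p) (M : ℤ_[p]) :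
    PadicCongr p 5 (halfSum p d (n + p * M))
      (M * (1 + M) * p ^ 2 / (4 ^ (p - 1) * d ^ n)
        * (1 + 2 * p * fermatQuotient p 2 + p ^ 2 * fermatQuotient p 2 ^ 2)) := by
  have hcast : (p : ℤ_[p]) = 2 * n + 1 := by simpa using congrArg (Nat.cast (R := ℤ_[p])) h
  have hfour : 1 + 2 * p * fermatQuotient p 2 + p ^ 2 * fermatQuotient p 2 ^ 2
      = (4 : ℚ_[p]) ^ (p - 1) := by
    have hfermat := one_add_mul_fermatQuotient (p := p) 2
    rw [show (4 : ℚ_[p]) = ((2 : ℤ) : ℚ_[p]) ^ 2 by norm_num, pow_right_comm, ← hfermat]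
    ring
  have harg : (n + p * M + n + 1 : ℤ_[p]) = p * M + p := by rw [hcast]; ring
  have hfour_ne : (4 : ℚ_[p]) ^ (p - 1) ≠ 0 :=
    pow_ne_zero _ (by norm_num)
  rw [halfSum_eq (ne_zero_of_not_dvd_num hd) h, harg, hfour]
  convert PadicCongr.mul_left (norm_pow_inv_le_one hd n) (pow_five_dvd_mul_ringChoose_sub hp M)
    using 1
  push_cast
  field_simp

theorem halfSum_congr_of_gt {d : ℚ} (hd : ¬ (p : ℤ) ∣ d.num) {n c : ℕ}
    (h : p = 2 * n + 1) (hc : c < p) (M : ℤ_[p]) :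
    PadicCongr p 2 (halfSum p d ((n + c : ℕ) + p * M))
      ((1 + M) * p / d ^ n * ((n + c + (n + 1)).choose (p + 1) : ℕ)) := by
  have hcast : (p : ℤ_[p]) = 2 * n + 1 := by simpa using congrArg (Nat.cast (R := ℤ_[p])) h
  have harg : ((n + c : ℕ) + p * M + n + 1 : ℤ_[p]) = p * (M + 1) + c := by
    push_cast; linear_combination -hcast
  rw [halfSum_eq (ne_zero_of_not_dvd_num hd) h, harg, show n + c + (n + 1) = p + c by omega]
  convert PadicCongr.mul_left (norm_pow_inv_le_one hd n) (sq_dvd_mul_ringChoose_sub hc M) using 1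
  push_cast
  ring

end HalfSum

theorem theorem1p3 (p : ℕ) [Fact p.Prime] (hp : 3 ≤ p)
    (d : ℚ) (hd0 : d ≠ 0) (hd : ¬ (p : ℤ) ∣ d.num)
    (x : ℤ_[p]) (a : ℕ) (ha : a = leastResidue p x)
    (m : ℚ_[p]) (hm : m = ((x : ℚ_[p]) - (a : ℚ_[p])) / (p : ℚ_[p])) :
    (3 < p → a < (p - 1) / 2 →
      PadicCongr p 4 (halfSum p d x)
        ((-1 : ℚ_[p]) ^ a * m * (-1 / (d : ℚ_[p])) ^ ((p - 1) / 2)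
            / (2 * ((Nat.choose (p - 1) (a + (p - 1) / 2) : ℕ) : ℚ_[p]))
          * ((p : ℚ_[p]) + 2 * (a : ℚ_[p]) * (p : ℚ_[p]) + (1 + 2 * m) * (p : ℚ_[p]) ^ 2
              + (1 + 2 * (a : ℚ_[p])) * m * (p : ℚ_[p]) ^ 3
                * ((genHarmonic 2 a : ℚ_[p]) - 4 * (genHarmonic 2 (2 * a) : ℚ_[p])))))
    ∧
    (3 < p → a = (p - 1) / 2 →
      PadicCongr p 5 (halfSum p d x)
        (m * (1 + m) * (p : ℚ_[p]) ^ 2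
            / ((4 : ℚ_[p]) ^ (p - 1) * (d : ℚ_[p]) ^ ((p - 1) / 2))
          * (1 + 2 * (p : ℚ_[p]) * (fermatQuotient p 2 : ℚ_[p])
              + (p : ℚ_[p]) ^ 2 * (fermatQuotient p 2 : ℚ_[p]) ^ 2)))
    ∧
    ((p - 1) / 2 < a →
      PadicCongr p 2 (halfSum p d x)
        ((1 + m) * (p : ℚ_[p]) / (d : ℚ_[p]) ^ ((p - 1) / 2)
          * ((Nat.choose (a + (p + 1) / 2) (p + 1) : ℕ) : ℚ_[p]))) := by
  obtain ⟨M, hx⟩ := exists_eq_leastResidue_add_mul x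
  obtain ⟨n, hn⟩ := Nat.Prime.odd_of_ne_two (p := p) Fact.out (by omega)
  have hap : a < p := ha ▸ ZMod.val_lt _
  have hmM : m = M := by
    rw [hm, hx, ← ha]
    push_cast
    rw [add_sub_cancel_left, mul_div_cancel_left₀ _ (Nat.cast_ne_zero.2 (NeZero.ne p))]
  rw [← ha] at hx
  rw [show (p - 1) / 2 = n by omega, show (p + 1) / 2 = n + 1 by omega, hmM, hx]
  refine ⟨fun hp3 han => ?_, fun hp3 han => ?_, fun han => ?_⟩
  · obtain ⟨b, rfl⟩ := Nat.exists_eq_add_of_le han.le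
    exact halfSum_congr_of_lt hd hn hp3 M
  · rw [han]
    exact halfSum_congr_of_eq hd hn hp3 M
  · obtain ⟨c, hc⟩ := Nat.exists_eq_add_of_le han.le
    rw [hc]
    exact halfSum_congr_of_gt hd hn (by omega) M
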